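/- Let $\mathcal K$ be a (strict) 2-category with comma objects: for all $f:A\to C$ and $g:B\to C$ there are $p:P\to A$, $q:P\to B$ and a 2-cell $\lambda:fp\to gq$ such that for every $X$, pasting with $\lambda$ is an isomorphism from the category $\mathcal K(X,P)$ to the comma category $\mathcal K(X,f)\downarrow\mathcal K(X,g)$. A 2-cell $\psi:h\to lf$ (with $f:A\to C$, $h:A\to V$, $l:C\to V$) exhibits $l$ as a *left Kan extension* of $h$ along $f$ if for every $k:C\to V$ and every $\sigma:h\to kf$ there is a unique $\tau:l\to k$ with $(\tau f)\psi=\sigma$; it exhibits $l$ as a *pointwise left Kan extension* if for every $g:B\to C$ and comma square $\lambda:fp\to gq$ as above, $(l\lambda)(\psi p)$ exhibits $lg$ as a left Kan extension of $hp$ along $q$. A lax square $\phi:fp\to gq$ (with $p:P\to A$, $q:P\to B$, $f:A\to C$, $g:B\to C$) is *exact* if whenever $\psi:h\to lf$ exhibits $l$ as a pointwise left Kan extension of $h$ along $f$, the 2-cell $(l\phi)(\psi p)$ exhibits $lg$ as a pointwise left Kan extension of $hp$ along $q$. Let $T$ be a 2-monad on $\mathcal K$, that is, a 2-functor $T:\mathcal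 K\to\mathcal K$ with 2-natural transformations $\eta:1\to T$, $\mu:T^2\to T$ satisfying the monad equations strictly. A *pseudo $T$-algebra* is an object $A$ with a 1-cell $a:TA\to A$ and invertible 2-cells $a_0:1_A\to a\eta_A$, $a_2:a\,T(a)\to a\mu_A$ such that $(a_2\eta_{TA})(a_0a)=\mathrm{id}_a$, $(a_2T(\eta_A))(aT(a_0))=\mathrm{id}_a$ and $(a_2\mu_{TA})(a_2T^2(a))=(a_2T(\mu_A))(aT(a_2))$. A *colax morphism* $(A,a)\to(B,b)$ of pseudo $T$-algebras is a 1-cell $f:A\to B$ with a 2-cell $\overline f:fa\to bT(f)$ such that $(\overline f\eta_A)(fa_0)=b_0f$ and $(\overline f\mu_A)(fa_2)=(b_2T^2(f))(bT(\overline f))(\overline fT(a))$; it is *exact* if $\overline f$, regarded as the lax square with sides $a:TA\to A$, $T(f):TA\to TB$, $f:A\to B$, $b:TB\to B$, is exact. Suppose that $T$ is *colax idempotent*, that is, $\eta T\dashv\mu$ in the 2-category of 2-functors $\mathcal K\to\mathcal K$, 2-natural transformations and modifications. Then every colax morphism of pseudo $T$-algebras is exact. -/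

import Mathlib

open CategoryTheory Bicategory

universe w v u

namespace AlgKan

/-! Conventions. A 2-category is a `Bicategory` which is `Bicategory.Strict`; its unitors and
associators are then identities (`eqToHom`s), and `⊗≫` is vertical composition of 2-cells with
these identities inserted. Composition of 1-cells is written in diagrammatic order `f ≫ g`. -/

section Kan

variable {K : Type u} [Bicategory.{w, v} K]

/-- The square
```
  P --q--> B
  |p       |g
  A --f--> C
```
with the 2-cell `lam` from `f ∘ p` to `g ∘ q` is a comma square: for every `X`, pasting with `lam`
is an isomorphism from the category of 1-cells `X ⟶ P` to the category whose objects are triples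
`(a : X ⟶ A, b : X ⟶ B, f ∘ a ⟶ g ∘ b)`. -/
structure IsComma {A B C P : K} (f : A ⟶ C) (g : B ⟶ C) (p : P ⟶ A) (q : P ⟶ B)
    (lam : p ≫ f ⟶ q ≫ g) : Prop where
  /-- bijectivity on objects -/
  existsUnique_lift : ∀ {X : K} (a : X ⟶ A) (b : X ⟶ B) (σ : a ≫ f ⟶ b ≫ g),
    ∃! x : X ⟶ P, ∃ (ha : x ≫ p = a) (hb : x ≫ q = b),
      (α_ x p f).hom ≫ x ◁ lam ≫ (α_ x q g).inv =
        eqToHom ha ▷ f ≫ σ ≫ eqToHom hb.symm ▷ g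
  /-- bijectivity on arrows -/
  existsUnique_lift₂ : ∀ {X : K} (x y : X ⟶ P) (ζ : x ≫ p ⟶ y ≫ p) (ξ : x ≫ q ⟶ y ≫ q),
    ζ ▷ f ≫ (α_ y p f).hom ≫ y ◁ lam ≫ (α_ y q g).inv =
      (α_ x p f).hom ≫ x ◁ lam ≫ (α_ x q g).inv ≫ ξ ▷ g →
    ∃! τ : x ⟶ y, τ ▷ p = ζ ∧ τ ▷ q = ξ

variable (K) in
/-- Every pair of 1-cells with common codomain has a comma object. -/
def HasCommaObjects : Prop :=
  ∀ {A B C : K} (f : A ⟶ C) (g : B ⟶ C),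
    ∃ (P : K) (p : P ⟶ A) (q : P ⟶ B) (lam : p ≫ f ⟶ q ≫ g), IsComma f g p q lam

/-- `ψ` exhibits `l` as a left Kan extension of `h` along `f`. -/
def IsLeftKan {A C V : K} (f : A ⟶ C) (h : A ⟶ V) (l : C ⟶ V) (ψ : h ⟶ f ≫ l) : Prop :=
  Nonempty (LeftExtension.mk l ψ).IsKan

/-- Given a square with a 2-cell `φ` from `f ∘ p` to `g ∘ q`, and `ψ` from `h` to `l ∘ f`, the
pasted 2-cell from `h ∘ p` to `(l ∘ g) ∘ q`. -/
def paste {A B C P V : K} {f : A ⟶ C} {g : B ⟶ C} {p : P ⟶ A} {q : P ⟶ B}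
    (φ : p ≫ f ⟶ q ≫ g) {h : A ⟶ V} {l : C ⟶ V} (ψ : h ⟶ f ≫ l) : p ≫ h ⟶ q ≫ g ≫ l :=
  p ◁ ψ ≫ (α_ p f l).inv ≫ φ ▷ l ≫ (α_ q g l).hom

/-- `ψ` exhibits `l` as a pointwise left Kan extension of `h` along `f` (Street): for every `g`
into the codomain of `f`, pasting `ψ` with the comma square of `f` and `g` gives a left Kan
extension. -/
def IsPointwiseLeftKan {A C V : K} (f : A ⟶ C) (h : A ⟶ V) (l : C ⟶ V) (ψ : h ⟶ f ≫ l) : Prop :=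
  ∀ {B P : K} (g : B ⟶ C) (p : P ⟶ A) (q : P ⟶ B) (lam : p ≫ f ⟶ q ≫ g),
    IsComma f g p q lam → IsLeftKan q (p ≫ h) (g ≫ l) (paste lam ψ)

/-- A lax square is exact when pasting with it preserves pointwise left Kan extensions. -/
def IsExactSquare {A B C P : K} (f : A ⟶ C) (g : B ⟶ C) (p : P ⟶ A) (q : P ⟶ B)
    (φ : p ≫ f ⟶ q ≫ g) : Prop :=
  ∀ {V : K} (h : A ⟶ V) (l : C ⟶ V) (ψ : h ⟶ f ≫ l),
    IsPointwiseLeftKan f h l ψ → IsPointwiseLeftKan q (p ≫ h) (g ≫ l) (paste φ ψ)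

end Kan

variable (K : Type u) [Bicategory.{w, v} K]

/-- A 2-monad on `K`: a 2-functor `T` with 2-natural transformations `η : 1 ⟶ T` and
`μ : T² ⟶ T` satisfying the monad equations. -/
structure TwoMonad where
  T : StrictPseudofunctor K K
  η : ∀ A : K, A ⟶ T.obj A
  η_naturality : ∀ {A B : K} (f : A ⟶ B), f ≫ η B = η A ≫ T.map f
  η_naturality₂ : ∀ {A B : K} {f g : A ⟶ B} (θ : f ⟶ g),
    θ ▷ η B ≫ eqToHom (η_naturality g) = eqToHom (η_naturality f) ≫ η A ◁ T.map₂ θ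
  μ : ∀ A : K, T.obj (T.obj A) ⟶ T.obj A
  μ_naturality : ∀ {A B : K} (f : A ⟶ B), T.map (T.map f) ≫ μ B = μ A ≫ T.map f
  μ_naturality₂ : ∀ {A B : K} {f g : A ⟶ B} (θ : f ⟶ g),
    T.map₂ (T.map₂ θ) ▷ μ B ≫ eqToHom (μ_naturality g) =
      eqToHom (μ_naturality f) ≫ μ A ◁ T.map₂ θ
  η_T_μ : ∀ A : K, η (T.obj A) ≫ μ A = 𝟙 (T.obj A)
  T_η_μ : ∀ A : K, T.map (η A) ≫ μ A = 𝟙 (T.obj A)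
  assoc : ∀ A : K, T.map (μ A) ≫ μ A = μ (T.obj A) ≫ μ A

namespace TwoMonad

variable {K}

/-- `ηT ⊣ μ` in the 2-category of 2-functors `K ⟶ K`, 2-natural transformations and
modifications: adjunctions `η (T A) ⊣ μ A` in `K` whose units and counits are the components of
modifications `1_T ⟶ μ ∘ ηT` and `ηT ∘ μ ⟶ 1_{T²}`. -/
def IsColaxIdempotent (M : TwoMonad K) : Prop :=
  ∃ adj : ∀ A : K, M.η (M.T.obj A) ⊣ M.μ A,
    (∀ {A B : K} (f : A ⟶ B),
      𝟙 (M.T.map f) ⊗≫ (adj A).unit ▷ M.T.map f ⊗≫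
          M.η (M.T.obj A) ◁ eqToHom (M.μ_naturality f).symm =
        𝟙 (M.T.map f) ⊗≫ M.T.map f ◁ (adj B).unit ⊗≫
          eqToHom (M.η_naturality (M.T.map f)) ▷ M.μ B ⊗≫
          𝟙 (M.η (M.T.obj A) ≫ M.T.map (M.T.map f) ≫ M.μ B)) ∧
    (∀ {A B : K} (f : A ⟶ B),
      𝟙 (M.μ A ≫ M.η (M.T.obj A) ≫ M.T.map (M.T.map f)) ⊗≫
          (adj A).counit ▷ M.T.map (M.T.map f) ⊗≫ 𝟙 (M.T.map (M.T.map f)) =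
        M.μ A ◁ eqToHom (M.η_naturality (M.T.map f)).symm ⊗≫
          eqToHom (M.μ_naturality f).symm ▷ M.η (M.T.obj B) ⊗≫
          M.T.map (M.T.map f) ◁ (adj B).counit ⊗≫ 𝟙 (M.T.map (M.T.map f)))

/-- A pseudo algebra of a 2-monad. -/
structure PseudoAlgebra (M : TwoMonad K) where
  A : K
  a : M.T.obj A ⟶ A
  a₀ : 𝟙 A ≅ M.η A ≫ a
  a₂ : M.T.map a ≫ a ≅ M.μ A ≫ a
  left_unit :
    𝟙 a ⊗≫ a ◁ a₀.hom ⊗≫ eqToHom (M.η_naturality a) ▷ a ⊗≫ M.η (M.T.obj A) ◁ a₂.hom ⊗≫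
      eqToHom (M.η_T_μ A) ▷ a ⊗≫ 𝟙 a = 𝟙 a
  right_unit :
    𝟙 a ⊗≫ (M.T.mapId A).inv ▷ a ≫ M.T.map₂ a₀.hom ▷ a ≫ (M.T.mapComp (M.η A) a).hom ▷ a ⊗≫
      M.T.map (M.η A) ◁ a₂.hom ⊗≫ eqToHom (M.T_η_μ A) ▷ a ⊗≫ 𝟙 a = 𝟙 a
  associativity :
    M.T.map (M.T.map a) ◁ a₂.hom ⊗≫ eqToHom (M.μ_naturality a) ▷ a ⊗≫
        M.μ (M.T.obj A) ◁ a₂.hom ⊗≫ 𝟙 ((M.μ (M.T.obj A) ≫ M.μ A) ≫ a) =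
      𝟙 (M.T.map (M.T.map a) ≫ M.T.map a ≫ a) ⊗≫
        (M.T.mapComp (M.T.map a) a).inv ▷ a ≫ M.T.map₂ a₂.hom ▷ a ≫
        (M.T.mapComp (M.μ A) a).hom ▷ a ⊗≫ M.T.map (M.μ A) ◁ a₂.hom ⊗≫
        eqToHom (M.assoc A) ▷ a

/-- A colax morphism of pseudo algebras. -/
structure ColaxMorphism {M : TwoMonad K} (X Y : PseudoAlgebra M) where
  f : X.A ⟶ Y.A
  fbar : X.a ≫ f ⟶ M.T.map f ≫ Y.a
  unit :
    𝟙 f ⊗≫ X.a₀.hom ▷ f ⊗≫ M.η X.A ◁ fbar =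
      𝟙 f ⊗≫ f ◁ Y.a₀.hom ⊗≫ eqToHom (M.η_naturality f) ▷ Y.a ⊗≫
        𝟙 (M.η X.A ≫ M.T.map f ≫ Y.a)
  structure_axiom :
    X.a₂.hom ▷ f ⊗≫ M.μ X.A ◁ fbar ⊗≫ eqToHom (M.μ_naturality f).symm ▷ Y.a =
      𝟙 ((M.T.map X.a ≫ X.a) ≫ f) ⊗≫ M.T.map X.a ◁ fbar ⊗≫
        (M.T.mapComp X.a f).inv ▷ Y.a ≫ M.T.map₂ fbar ▷ Y.a ≫
        (M.T.mapComp (M.T.map f) Y.a).hom ▷ Y.a ⊗≫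
        M.T.map (M.T.map f) ◁ Y.a₂.hom ⊗≫ 𝟙 ((M.T.map (M.T.map f) ≫ M.μ Y.A) ≫ Y.a)

/-- A colax morphism is exact when the lax square formed by its coherence 2-cell is exact. -/
def ColaxMorphism.IsExact {M : TwoMonad K} {X Y : PseudoAlgebra M} (F : ColaxMorphism X Y) :
    Prop :=
  IsExactSquare F.f Y.a X.a (M.T.map F.f) F.fbar

end TwoMonad

end AlgKan

namespace AlgKan

section

variable {K : Type u} [Bicategory.{w, v} K]

/-! For colax idempotent `T`, the structure map `a` of a pseudo algebra is right adjoint to `η` with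
unit `a₀` (`IsColaxIdempotent.exists_adjunction`). The unit axiom of a colax morphism then says that
`fbar` is the mate of the naturality identity of `η` at `f`, so its mate is invertible. Such a
square of right adjoints is exact (`isExactSquare_of_adjunction`): for `y` into `B'`, transposing
across `L' ⊣ R'` turns 2-cells into `y ≫ R'` into 2-cells into `y`. This compares the comma object
of `f` and `y ≫ R'` with that of `t` and `y` by 1-cells `s` and `r` and a counit-like 2-cell `κ`.
Kan extension along the first projection to the domain of `y` therefore yields it along the second
(`IsLeftKan.of_restrict`). -/

theorem IsComma.exists_lift {A B C P : K} {f : A ⟶ C} {g : B ⟶ C} {p : P ⟶ A} {q : P ⟶ B}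
    {lam : p ≫ f ⟶ q ≫ g} (H : IsComma f g p q lam) {X : K} (a : X ⟶ A) (b : X ⟶ B)
    (σ : a ≫ f ⟶ b ≫ g) :
    ∃ (x : X ⟶ P) (α : x ≫ p ≅ a) (β : x ≫ q ≅ b),
      (α_ x p f).hom ≫ x ◁ lam ≫ (α_ x q g).inv = α.hom ▷ f ≫ σ ≫ β.inv ▷ g := by
  -- Equalities of 1-cells are weakened to isomorphisms, so later pastings need no transport.
  obtain ⟨x, ⟨ha, hb, hx⟩, -⟩ := H.existsUnique_lift a b σ
  exact ⟨x, eqToIso ha, eqToIso hb, by simpa using hx⟩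

theorem isLeftKan_iff {A C V : K} {f : A ⟶ C} {h : A ⟶ V} {l : C ⟶ V} {ψ : h ⟶ f ≫ l} :
    IsLeftKan f h l ψ ↔
      ∀ (k : C ⟶ V) (σ : h ⟶ f ≫ k), ∃! τ : l ⟶ k, ψ ≫ f ◁ τ = σ := by
  constructor
  · rintro ⟨H⟩ k σ
    refine ⟨H.desc (LeftExtension.mk k σ), H.fac (LeftExtension.mk k σ), fun τ hτ => ?_⟩
    exact H.hom_ext (hτ.trans (H.fac (LeftExtension.mk k σ)).symm)
  · intro H
    choose d hd hu using H
    exact ⟨LeftExtension.IsKan.mk (fun s => LeftExtension.homMk (d s.extension s.unit) (hd _ _))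
      fun s τ => by
        ext
        exact hu _ _ _ (LeftExtension.w τ)⟩

/-- A left Kan extension along `q'` can be recognised after restriction along `s`, when `s` has a
"right adjoint" `r` over the common codomain of `q` and `q'`. -/
theorem IsLeftKan.of_restrict {P P' Z V : K} {q : P ⟶ Z} {q' : P' ⟶ Z} {h : P ⟶ V} {h' : P' ⟶ V}
    {l : Z ⟶ V} {ψ : h ⟶ q ≫ l} {ψ' : h' ⟶ q' ≫ l} (H : IsLeftKan q h l ψ)
    (s : P ⟶ P') (r : P' ⟶ P) (κ : r ≫ s ⟶ 𝟙 P') (β : s ≫ q' ⟶ q) (δ : r ≫ q ⟶ q')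
    (η : h ⟶ s ≫ h') (θ : h' ⟶ r ≫ h)
    (hκ : κ ▷ q' = (α_ r s q').hom ≫ r ◁ β ≫ δ ≫ (λ_ q').inv)
    (hη : θ ≫ r ◁ η ≫ (α_ r s h').inv ≫ κ ▷ h' ≫ (λ_ h').hom = 𝟙 h')
    (hψ : η ≫ s ◁ ψ' ≫ (α_ s q' l).inv ≫ β ▷ l = ψ) :
    IsLeftKan q' h' l ψ' := by
  -- Restriction of 2-cells along `s` is injective: going back along `r` and cancelling with `κ`
  -- recovers `σ`.
  have key : ∀ (k : Z ⟶ V) (σ : h' ⟶ q' ≫ k),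
      θ ≫ r ◁ (η ≫ s ◁ σ ≫ (α_ s q' k).inv ≫ β ▷ k) ≫ (α_ r q k).inv ≫ δ ▷ k = σ := by
    intro k σ
    calc _ = θ ≫ r ◁ η ⊗≫ (r ≫ s) ◁ σ ⊗≫
          ((α_ r s q').hom ≫ r ◁ β ≫ δ ≫ (λ_ q').inv) ▷ k ⊗≫ 𝟙 _ := by bicategory
      _ = θ ≫ r ◁ η ⊗≫ ((r ≫ s) ◁ σ ≫ κ ▷ (q' ≫ k)) ⊗≫ 𝟙 _ := by
          rw [← hκ]; bicategory
      _ = (θ ≫ r ◁ η ≫ (α_ r s h').inv ≫ κ ▷ h' ≫ (λ_ h').hom) ≫ σ := by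
          rw [whisker_exchange]; bicategory
      _ = σ := by rw [hη, Category.id_comp]
  have compat : ∀ (k : Z ⟶ V) (τ : l ⟶ k),
      η ≫ s ◁ (ψ' ≫ q' ◁ τ) ≫ (α_ s q' k).inv ≫ β ▷ k = ψ ≫ q ◁ τ := by
    intro k τ
    rw [← hψ]
    calc _ = η ≫ s ◁ ψ' ≫ (α_ s q' l).inv ≫ ((s ≫ q') ◁ τ ≫ β ▷ k) := by bicategory
      _ = _ := by rw [whisker_exchange]; simp
  rw [isLeftKan_iff] at H ⊢
  intro k σ
  obtain ⟨τ, hτ, hu⟩ := H k (η ≫ s ◁ σ ≫ (α_ s q' k).inv ≫ β ▷ k)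
  refine ⟨τ, ?_, fun τ' hτ' => hu τ' ?_⟩
  · dsimp only at hτ ⊢
    rw [← key k (ψ' ≫ q' ◁ τ), compat, hτ, key]
  · dsimp only at hτ' ⊢
    rw [← compat, hτ']

theorem IsLeftKan.of_iso {A C V : K} {f : A ⟶ C} {h : A ⟶ V} {l l' : C ⟶ V} {ψ : h ⟶ f ≫ l}
    {ψ' : h ⟶ f ≫ l'} (H : IsLeftKan f h l ψ) (i : l ≅ l') (hi : ψ ≫ f ◁ i.hom = ψ') :
    IsLeftKan f h l' ψ' :=
  H.map fun H => H.ofIsoKan (StructuredArrow.isoMk i hi)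

/-! ### Exactness of squares of right adjoints -/

section Square

variable {A A' B B' : K} {L : A ⟶ A'} {R : A' ⟶ A} {L' : B ⟶ B'} {R' : B' ⟶ B}
  {f : A ⟶ B} {t : A' ⟶ B'}

/-- If `φ` is compatible with the units of two adjunctions, then it is so with the counits. -/
theorem counit_eq_of_unit_eq (adj : L ⊣ R) (adj' : L' ⊣ R') (e : f ≫ L' ≅ L ≫ t)
    (φ : R ≫ f ⟶ t ≫ R')
    (hφ : 𝟙 f ⊗≫ adj.unit ▷ f ⊗≫ L ◁ φ =
      𝟙 f ⊗≫ f ◁ adj'.unit ⊗≫ e.hom ▷ R' ⊗≫ 𝟙 (L ≫ t ≫ R')) :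
    R ◁ e.inv ⊗≫ φ ▷ L' ⊗≫ t ◁ adj'.counit = 𝟙 (R ≫ L ≫ t) ⊗≫ adj.counit ▷ t ⊗≫ 𝟙 (t ≫ 𝟙 B') := by
  have h₁ := adj.right_triangle
  have h₂ := adj'.left_triangle
  dsimp only [rightZigzag] at h₁
  dsimp only [leftZigzag] at h₂
  calc
    -- Expanding the identity of `R` by a triangle identity creates the unit to which `hφ` applies.
    _ = R ◁ e.inv ⊗≫ ((ρ_ R).hom ≫ (λ_ R).inv) ▷ (f ≫ L') ⊗≫ φ ▷ L' ⊗≫ t ◁ adj'.counit := by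
        bicategory
    _ = R ◁ e.inv ⊗≫ R ◁ adj.unit ▷ f ▷ L' ⊗≫
          (adj.counit ▷ (R ≫ f) ≫ 𝟙 A' ◁ φ) ▷ L' ⊗≫ t ◁ adj'.counit := by
        rw [← h₁]; bicategory
    _ = R ◁ e.inv ⊗≫ R ◁ (𝟙 f ⊗≫ adj.unit ▷ f ⊗≫ L ◁ φ) ▷ L' ⊗≫
          (adj.counit ▷ (t ≫ R' ≫ L') ≫ 𝟙 A' ◁ t ◁ adj'.counit) ⊗≫ 𝟙 _ := by
        rw [← whisker_exchange]; bicategory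
    _ = R ◁ e.inv ⊗≫ R ◁ f ◁ adj'.unit ▷ L' ⊗≫ R ◁ (e.hom ▷ (R' ≫ L') ≫
          (L ≫ t) ◁ adj'.counit) ⊗≫ adj.counit ▷ t ⊗≫ 𝟙 _ := by
        rw [hφ, ← whisker_exchange]; bicategory
    _ = R ◁ e.inv ⊗≫ R ◁ f ◁ (adj'.unit ▷ L' ⊗≫ L' ◁ adj'.counit) ⊗≫ R ◁ e.hom ⊗≫
          adj.counit ▷ t ⊗≫ 𝟙 _ := by
        rw [← whisker_exchange]; bicategory
    _ = 𝟙 _ ⊗≫ R ◁ (e.inv ≫ e.hom) ⊗≫ adj.counit ▷ t ⊗≫ 𝟙 _ := by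
        rw [h₂]; bicategory
    _ = _ := by
        rw [e.inv_hom_id]; bicategory

/-- A square of right adjoints whose mate is invertible is exact. -/
theorem isExactSquare_of_adjunction (hK : HasCommaObjects K) (adj : L ⊣ R) (adj' : L' ⊣ R')
    (e : f ≫ L' ≅ L ≫ t) (φ : R ≫ f ⟶ t ≫ R')
    (hφ : 𝟙 f ⊗≫ adj.unit ▷ f ⊗≫ L ◁ φ =
      𝟙 f ⊗≫ f ◁ adj'.unit ⊗≫ e.hom ▷ R' ⊗≫ 𝟙 (L ≫ t ≫ R')) :
    IsExactSquare f R' R t φ := by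
  intro V h l ψ hψ Z P' y p' q' lam' H'
  have h₁ := adj.right_triangle
  have h₂ := adj'.right_triangle
  dsimp only [rightZigzag] at h₁ h₂
  have hc := counit_eq_of_unit_eq adj adj' e φ hφ
  obtain ⟨P, p, q, lam, H⟩ := hK f (y ≫ R')
  -- `s` classifies the transpose of `lam` across `L' ⊣ R'`, with `e` exchanging `f ≫ L'` for `L ≫
  -- t`; `r` applies `R` and pastes with `φ`.
  obtain ⟨s, α, β, hs⟩ := H'.exists_lift (p ≫ L) q
    (𝟙 _ ⊗≫ p ◁ e.inv ⊗≫ lam ▷ L' ⊗≫ (q ≫ y) ◁ adj'.counit ⊗≫ 𝟙 _)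
  obtain ⟨r, γ, δ, hr⟩ := H.exists_lift (p' ≫ R) q'
    (𝟙 _ ⊗≫ p' ◁ φ ⊗≫ lam' ▷ R' ⊗≫ 𝟙 _)
  -- Up to the comparison isomorphisms, `κ` is the counit of `L ⊣ R` over `A'` and an identity over
  -- `Z`; `hc` makes the two components compatible.
  obtain ⟨κ, ⟨hκp, hκq⟩, -⟩ := H'.existsUnique_lift₂ (r ≫ s) (𝟙 P')
    ((α_ _ _ _).hom ≫ r ◁ α.hom ⊗≫ γ.hom ▷ L ⊗≫ p' ◁ adj.counit ⊗≫ 𝟙 _)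
    ((α_ _ _ _).hom ≫ r ◁ β.hom ≫ δ.hom ≫ (λ_ _).inv) (by
      have hr' : r ◁ lam = 𝟙 _ ⊗≫ γ.hom ▷ f ⊗≫ p' ◁ φ ⊗≫ lam' ▷ R' ⊗≫
          δ.inv ▷ (y ≫ R') ⊗≫ 𝟙 _ := by
        calc _ = 𝟙 _ ⊗≫ ((α_ r p f).hom ≫ r ◁ lam ≫ (α_ r q (y ≫ R')).inv) ⊗≫ 𝟙 _ := by
              bicategory
          _ = _ := by rw [hr]; bicategory
      calc
        _ = 𝟙 _ ⊗≫ r ◁ α.hom ▷ t ⊗≫ γ.hom ▷ (L ≫ t) ⊗≫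
              p' ◁ (𝟙 (R ≫ L ≫ t) ⊗≫ adj.counit ▷ t ⊗≫ 𝟙 (t ≫ 𝟙 B')) ⊗≫ lam' ⊗≫ 𝟙 _ := by
            bicategory
        _ = 𝟙 _ ⊗≫ r ◁ α.hom ▷ t ⊗≫ (γ.hom ▷ (L ≫ t) ≫ (p' ≫ R) ◁ e.inv) ⊗≫ p' ◁ φ ▷ L' ⊗≫
              ((p' ≫ t) ◁ adj'.counit ≫ lam' ▷ 𝟙 B') ⊗≫ 𝟙 _ := by
            rw [← hc]; bicategory
        _ = 𝟙 _ ⊗≫ r ◁ α.hom ▷ t ⊗≫ (r ≫ p) ◁ e.inv ⊗≫ γ.hom ▷ f ▷ L' ⊗≫ p' ◁ φ ▷ L' ⊗≫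
              lam' ▷ R' ▷ L' ⊗≫ (q' ≫ y) ◁ adj'.counit ⊗≫ 𝟙 _ := by
            rw [← whisker_exchange γ.hom e.inv, whisker_exchange lam' adj'.counit]; bicategory
        _ = 𝟙 _ ⊗≫ r ◁ α.hom ▷ t ⊗≫ (r ≫ p) ◁ e.inv ⊗≫ γ.hom ▷ f ▷ L' ⊗≫ p' ◁ φ ▷ L' ⊗≫
              lam' ▷ R' ▷ L' ⊗≫ (δ.inv ≫ δ.hom) ▷ (y ≫ R' ≫ L') ⊗≫
              (q' ≫ y) ◁ adj'.counit ⊗≫ 𝟙 _ := by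
            rw [δ.inv_hom_id]; bicategory
        _ = 𝟙 _ ⊗≫ r ◁ α.hom ▷ t ⊗≫ (r ≫ p) ◁ e.inv ⊗≫
              (𝟙 (r ≫ p ≫ f) ⊗≫ γ.hom ▷ f ⊗≫ p' ◁ φ ⊗≫ lam' ▷ R' ⊗≫ δ.inv ▷ (y ≫ R') ⊗≫
                𝟙 (r ≫ q ≫ y ≫ R')) ▷ L' ⊗≫
              (δ.hom ▷ y ▷ (R' ≫ L') ≫ (q' ≫ y) ◁ adj'.counit) ⊗≫ 𝟙 _ := by
            bicategory
        _ = 𝟙 _ ⊗≫ r ◁ α.hom ▷ t ⊗≫ (r ≫ p) ◁ e.inv ⊗≫ r ◁ lam ▷ L' ⊗≫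
              ((r ≫ q) ≫ y) ◁ adj'.counit ⊗≫ r ◁ (β.inv ≫ β.hom) ▷ y ⊗≫ δ.hom ▷ y ⊗≫ 𝟙 _ := by
            rw [← hr', ← whisker_exchange, β.inv_hom_id]; bicategory
        _ = 𝟙 _ ⊗≫ r ◁ (α.hom ▷ t ≫ (𝟙 ((p ≫ L) ≫ t) ⊗≫ p ◁ e.inv ⊗≫ lam ▷ L' ⊗≫
              (q ≫ y) ◁ adj'.counit ⊗≫ 𝟙 (q ≫ y)) ≫ β.inv ▷ y) ⊗≫ r ◁ β.hom ▷ y ⊗≫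
              δ.hom ▷ y ⊗≫ 𝟙 _ := by
            bicategory
        _ = _ := by
            rw [← hs]; bicategory)
  refine (((hψ (y ≫ R') p q lam H).of_iso (α_ y R' l) rfl)).of_restrict s r κ β.hom δ.hom
    (𝟙 _ ⊗≫ p ◁ adj.unit ▷ h ⊗≫ α.inv ▷ (R ≫ h) ⊗≫ 𝟙 _)
    (𝟙 _ ⊗≫ γ.inv ▷ h ⊗≫ 𝟙 _) hκq ?_ ?_
  · calc
      _ = 𝟙 _ ⊗≫ γ.inv ▷ h ⊗≫ r ◁ p ◁ adj.unit ▷ h ⊗≫ r ◁ α.inv ▷ (R ≫ h) ⊗≫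
            (κ ▷ p') ▷ (R ≫ h) ⊗≫ 𝟙 _ := by bicategory
      _ = 𝟙 _ ⊗≫ γ.inv ▷ h ⊗≫ r ◁ p ◁ adj.unit ▷ h ⊗≫ r ◁ (α.inv ≫ α.hom) ▷ (R ≫ h) ⊗≫
            γ.hom ▷ (L ≫ R ≫ h) ⊗≫ p' ◁ adj.counit ▷ (R ≫ h) ⊗≫ 𝟙 _ := by
          rw [hκp]; bicategory
      _ = 𝟙 _ ⊗≫ γ.inv ▷ h ⊗≫ ((r ≫ p) ◁ adj.unit ≫ γ.hom ▷ (L ≫ R)) ▷ h ⊗≫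
            p' ◁ adj.counit ▷ (R ≫ h) ⊗≫ 𝟙 _ := by
          rw [α.inv_hom_id]; bicategory
      _ = 𝟙 _ ⊗≫ (γ.inv ≫ γ.hom) ▷ h ⊗≫ p' ◁ (R ◁ adj.unit ⊗≫ adj.counit ▷ R) ▷ h ⊗≫ 𝟙 _ := by
          rw [whisker_exchange]; bicategory
      _ = _ := by
          rw [γ.inv_hom_id, h₁]; bicategory
  · unfold paste
    calc
      _ = 𝟙 _ ⊗≫ p ◁ adj.unit ▷ h ⊗≫ (α.inv ▷ (R ≫ h) ≫ (s ≫ p') ◁ (R ◁ ψ ⊗≫ φ ▷ l)) ⊗≫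
            ((α_ s p' t).hom ≫ s ◁ lam' ≫ (α_ s q' y).inv) ▷ (R' ≫ l) ⊗≫
            β.hom ▷ (y ≫ R' ≫ l) := by bicategory
      _ = 𝟙 _ ⊗≫ p ◁ (adj.unit ▷ h ≫ (L ≫ R) ◁ ψ) ⊗≫ (p ≫ L) ◁ φ ▷ l ⊗≫
            (α.inv ≫ α.hom) ▷ (t ≫ R' ≫ l) ⊗≫ p ◁ e.inv ▷ (R' ≫ l) ⊗≫ lam ▷ (L' ≫ R' ≫ l) ⊗≫
            (q ≫ y) ◁ adj'.counit ▷ (R' ≫ l) ⊗≫ (β.inv ≫ β.hom) ▷ (y ≫ R' ≫ l) := by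
          rw [← whisker_exchange, hs]; bicategory
      _ = 𝟙 _ ⊗≫ p ◁ ψ ⊗≫ p ◁ (𝟙 f ⊗≫ adj.unit ▷ f ⊗≫ L ◁ φ) ▷ l ⊗≫
            p ◁ e.inv ▷ (R' ≫ l) ⊗≫ lam ▷ (L' ≫ R' ≫ l) ⊗≫
            (q ≫ y) ◁ adj'.counit ▷ (R' ≫ l) ⊗≫ 𝟙 _ := by
          rw [← whisker_exchange, α.inv_hom_id, β.inv_hom_id]; bicategory
      _ = 𝟙 _ ⊗≫ p ◁ ψ ⊗≫ p ◁ f ◁ adj'.unit ▷ l ⊗≫ p ◁ (e.hom ≫ e.inv) ▷ (R' ≫ l) ⊗≫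
            lam ▷ (L' ≫ R' ≫ l) ⊗≫ (q ≫ y) ◁ adj'.counit ▷ (R' ≫ l) ⊗≫ 𝟙 _ := by
          rw [hφ]; bicategory
      _ = 𝟙 _ ⊗≫ p ◁ ψ ⊗≫ ((p ≫ f) ◁ adj'.unit ≫ lam ▷ (L' ≫ R')) ▷ l ⊗≫
            (q ≫ y) ◁ adj'.counit ▷ (R' ≫ l) ⊗≫ 𝟙 _ := by
          rw [e.hom_inv_id]; bicategory
      _ = 𝟙 _ ⊗≫ p ◁ ψ ⊗≫ lam ▷ l ⊗≫
            (q ≫ y) ◁ (R' ◁ adj'.unit ⊗≫ adj'.counit ▷ R') ▷ l ⊗≫ 𝟙 _ := by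
          rw [whisker_exchange]; bicategory
      _ = _ := by
          rw [h₂]
          bicategory

end Square

/-! ### Adjunctions from algebra structures -/

/-- If `F ⊣ G` and `F ≫ G` is isomorphic to the identity, then the isomorphism can be taken as the
unit of an adjunction. -/
def adjunctionOfIso {A B : K} {F : A ⟶ B} {G : B ⟶ A} (adj : F ⊣ G) (i : F ≫ G ≅ 𝟙 A) :
    F ⊣ G where
  unit := i.inv
  -- The endomorphism `adj.unit ≫ i.hom` of `𝟙 A` compensates for the change of unit; interchange
  -- slides it past `i.inv` to restore `adj.unit`.
  counit := 𝟙 _ ⊗≫ G ◁ (adj.unit ≫ i.hom) ▷ F ⊗≫ adj.counit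
  left_triangle := by
    dsimp only [leftZigzag]
    calc
      _ = 𝟙 _ ⊗≫ (i.inv ▷ 𝟙 A ≫ (F ≫ G) ◁ (adj.unit ≫ i.hom)) ▷ F ⊗≫ F ◁ adj.counit := by
          bicategory
      _ = 𝟙 _ ⊗≫ (adj.unit ≫ i.hom ≫ i.inv) ▷ F ⊗≫ F ◁ adj.counit := by
          rw [← whisker_exchange]; bicategory
      _ = 𝟙 _ ⊗≫ leftZigzag adj.unit adj.counit := by
          rw [i.hom_inv_id, leftZigzag]; bicategory
      _ = _ := by
          rw [adj.left_triangle]; bicategory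
  right_triangle := by
    dsimp only [rightZigzag]
    calc
      _ = 𝟙 _ ⊗≫ G ◁ (𝟙 A ◁ i.inv ≫ (adj.unit ≫ i.hom) ▷ (F ≫ G)) ⊗≫ adj.counit ▷ G := by
          bicategory
      _ = 𝟙 _ ⊗≫ G ◁ (adj.unit ≫ i.hom ≫ i.inv) ⊗≫ adj.counit ▷ G := by
          rw [whisker_exchange]; bicategory
      _ = 𝟙 _ ⊗≫ rightZigzag adj.unit adj.counit := by
          rw [i.hom_inv_id, rightZigzag]; bicategory
      _ = _ := by
          rw [adj.right_triangle]; bicategory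

/-- Given an adjunction `ηT ⊣ m` with unit `i.inv`, an algebra structure `a` with unit isomorphism
`a₀` and associativity isomorphism `a₂` is right adjoint to `η`, with unit `a₀`. Here `n` and `n'`
stand for the naturality of the unit of the monad at `a` and `η`, and `T₀` for the image of `a₀`
under the monad. -/
def adjunctionOfAlgebra {A TA TTA : K} {η : A ⟶ TA} {ηT Tη : TA ⟶ TTA} {m Ta : TTA ⟶ TA}
    {a : TA ⟶ A} (adj : ηT ⊣ m) (i : ηT ≫ m ≅ 𝟙 TA) (hi : adj.unit = i.inv)
    (t : Tη ≫ m ≅ 𝟙 TA) (n : a ≫ η ≅ ηT ≫ Ta) (n' : η ≫ ηT ≅ η ≫ Tη)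
    (T₀ : 𝟙 TA ≅ Tη ≫ Ta) (a₀ : 𝟙 A ≅ η ≫ a) (a₂ : Ta ≫ a ≅ m ≫ a)
    (left_unit : 𝟙 a ⊗≫ a ◁ a₀.hom ⊗≫ n.hom ▷ a ⊗≫ ηT ◁ a₂.hom ⊗≫ i.hom ▷ a ⊗≫ 𝟙 a = 𝟙 a)
    (right_unit : 𝟙 a ⊗≫ T₀.hom ▷ a ⊗≫ Tη ◁ a₂.hom ⊗≫ t.hom ▷ a ⊗≫ 𝟙 a = 𝟙 a)
    (unit_comp : η ◁ t.inv ⊗≫ n'.inv ▷ m ⊗≫ η ◁ i.hom = 𝟙 _)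
    (unit_nat : a₀.hom ▷ η ⊗≫ η ◁ n.hom ⊗≫ n'.hom ▷ Ta = 𝟙 _ ⊗≫ η ◁ T₀.hom ⊗≫ 𝟙 _) :
    η ⊣ a where
  unit := a₀.hom
  -- In applicative order: `η a = T(a) ηT = T(a) ηT μ T(η) → T(a) T(η) ≅ 1`.
  counit := n.hom ⊗≫ t.inv ▷ (ηT ≫ Ta) ⊗≫ Tη ◁ adj.counit ▷ Ta ⊗≫ T₀.inv
  left_triangle := by
    -- As the unit is `i.inv`, the triangle identity determines this whiskering of the counit; `n'`
    -- moves `ηT` into position to use it.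
    have h : ηT ◁ adj.counit = 𝟙 _ ⊗≫ i.hom ▷ ηT ⊗≫ 𝟙 _ := by
      have := adj.left_triangle
      dsimp only [leftZigzag] at this
      calc
        _ = 𝟙 _ ⊗≫ (i.hom ≫ i.inv) ▷ ηT ⊗≫ ηT ◁ adj.counit := by
            rw [i.hom_inv_id]; bicategory
        _ = 𝟙 _ ⊗≫ i.hom ▷ ηT ⊗≫ (adj.unit ▷ ηT ⊗≫ ηT ◁ adj.counit) := by
            rw [hi]; bicategory
        _ = _ := by rw [this]; bicategory
    dsimp only [leftZigzag]
    calc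
      _ = a₀.hom ▷ η ⊗≫ η ◁ n.hom ⊗≫ η ◁ t.inv ▷ (ηT ≫ Ta) ⊗≫
            (n'.inv ≫ n'.hom) ▷ (m ≫ ηT ≫ Ta) ⊗≫ η ◁ Tη ◁ adj.counit ▷ Ta ⊗≫ η ◁ T₀.inv := by
          rw [n'.inv_hom_id]; bicategory
      _ = a₀.hom ▷ η ⊗≫ η ◁ n.hom ⊗≫ η ◁ t.inv ▷ (ηT ≫ Ta) ⊗≫
            n'.inv ▷ (m ≫ ηT ≫ Ta) ⊗≫ (n'.hom ▷ (m ≫ ηT) ≫ (η ≫ Tη) ◁ adj.counit) ▷ Ta ⊗≫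
            η ◁ T₀.inv := by
          bicategory
      _ = a₀.hom ▷ η ⊗≫ η ◁ n.hom ⊗≫ η ◁ t.inv ▷ (ηT ≫ Ta) ⊗≫
            n'.inv ▷ (m ≫ ηT ≫ Ta) ⊗≫ η ◁ (ηT ◁ adj.counit) ▷ Ta ⊗≫ n'.hom ▷ Ta ⊗≫
            η ◁ T₀.inv := by
          rw [← whisker_exchange]; bicategory
      _ = a₀.hom ▷ η ⊗≫ η ◁ n.hom ⊗≫ (η ◁ t.inv ⊗≫ n'.inv ▷ m ⊗≫ η ◁ i.hom) ▷ (ηT ≫ Ta) ⊗≫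
            n'.hom ▷ Ta ⊗≫ η ◁ T₀.inv := by
          rw [h]; bicategory
      _ = (a₀.hom ▷ η ⊗≫ η ◁ n.hom ⊗≫ n'.hom ▷ Ta) ⊗≫ η ◁ T₀.inv := by
          rw [unit_comp]; bicategory
      _ = 𝟙 _ ⊗≫ η ◁ (T₀.hom ≫ T₀.inv) ⊗≫ 𝟙 _ := by
          rw [unit_nat]; bicategory
      _ = _ := by
          rw [T₀.hom_inv_id]; bicategory
  right_triangle := by
    have h : adj.counit ▷ m = 𝟙 _ ⊗≫ m ◁ i.hom ⊗≫ 𝟙 _ := by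
      have := adj.right_triangle
      dsimp only [rightZigzag] at this
      calc
        _ = 𝟙 _ ⊗≫ m ◁ (i.hom ≫ i.inv) ⊗≫ adj.counit ▷ m := by
            rw [i.hom_inv_id]; bicategory
        _ = 𝟙 _ ⊗≫ m ◁ i.hom ⊗≫ (m ◁ adj.unit ⊗≫ adj.counit ▷ m) := by
            rw [hi]; bicategory
        _ = _ := by rw [this]; bicategory
    -- The inverse of `right_unit`, which absorbs what is left once `a₂` has been slid past the
    -- counit.
    have right_unit' : t.inv ▷ a ⊗≫ Tη ◁ a₂.inv ⊗≫ T₀.inv ▷ a = 𝟙 _ := by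
      calc
        _ = t.inv ▷ a ⊗≫ Tη ◁ a₂.inv ⊗≫ T₀.inv ▷ a ⊗≫ 𝟙 a ⊗≫ 𝟙 _ := by bicategory
        _ = t.inv ▷ a ⊗≫ Tη ◁ a₂.inv ⊗≫ (T₀.inv ≫ T₀.hom) ▷ a ⊗≫ Tη ◁ a₂.hom ⊗≫
              t.hom ▷ a ⊗≫ 𝟙 _ := by
            rw [← right_unit]; bicategory
        _ = t.inv ▷ a ⊗≫ Tη ◁ (a₂.inv ≫ a₂.hom) ⊗≫ t.hom ▷ a ⊗≫ 𝟙 _ := by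
            rw [T₀.inv_hom_id]; bicategory
        _ = (t.inv ≫ t.hom) ▷ a ⊗≫ 𝟙 _ := by
            rw [a₂.inv_hom_id]; bicategory
        _ = _ := by rw [t.inv_hom_id]; bicategory
    dsimp only [rightZigzag]
    calc
      _ = a ◁ a₀.hom ⊗≫ n.hom ▷ a ⊗≫ t.inv ▷ (ηT ≫ Ta ≫ a) ⊗≫
            Tη ◁ adj.counit ▷ (Ta ≫ a) ⊗≫ Tη ◁ (a₂.hom ≫ a₂.inv) ⊗≫ T₀.inv ▷ a := by
          rw [a₂.hom_inv_id]; bicategory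
      _ = a ◁ a₀.hom ⊗≫ n.hom ▷ a ⊗≫ t.inv ▷ (ηT ≫ Ta ≫ a) ⊗≫
            Tη ◁ (adj.counit ▷ (Ta ≫ a) ≫ 𝟙 TTA ◁ a₂.hom) ⊗≫ Tη ◁ a₂.inv ⊗≫ T₀.inv ▷ a := by
          bicategory
      _ = a ◁ a₀.hom ⊗≫ n.hom ▷ a ⊗≫ t.inv ▷ (ηT ≫ Ta ≫ a) ⊗≫
            (Tη ≫ m) ◁ ηT ◁ a₂.hom ⊗≫ Tη ◁ (adj.counit ▷ m) ▷ a ⊗≫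
            Tη ◁ a₂.inv ⊗≫ T₀.inv ▷ a := by
          rw [← whisker_exchange]; bicategory
      _ = a ◁ a₀.hom ⊗≫ n.hom ▷ a ⊗≫ (t.inv ▷ (ηT ≫ Ta ≫ a) ≫
            (Tη ≫ m) ◁ (ηT ◁ a₂.hom ⊗≫ i.hom ▷ a)) ⊗≫ Tη ◁ a₂.inv ⊗≫ T₀.inv ▷ a := by
          rw [h]; bicategory
      _ = 𝟙 _ ⊗≫ (𝟙 a ⊗≫ a ◁ a₀.hom ⊗≫ n.hom ▷ a ⊗≫ ηT ◁ a₂.hom ⊗≫ i.hom ▷ a ⊗≫ 𝟙 a) ⊗≫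
            (t.inv ▷ a ⊗≫ Tη ◁ a₂.inv ⊗≫ T₀.inv ▷ a) := by
          rw [← whisker_exchange]; bicategory
      _ = _ := by
          rw [left_unit, right_unit']; bicategory

end

/-! ### Pseudo algebras of a colax idempotent 2-monad -/

namespace TwoMonad

variable {K : Type u} [Bicategory.{w, v} K] [Bicategory.Strict K] {M : TwoMonad K}

/-- The structure map of a pseudo algebra of a colax idempotent 2-monad is right adjoint to the
unit of the 2-monad. -/
theorem IsColaxIdempotent.exists_adjunction (hM : M.IsColaxIdempotent) (X : PseudoAlgebra M) :
    ∃ adj : M.η X.A ⊣ X.a, adj.unit = X.a₀.hom := by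
  obtain ⟨adj, -, -⟩ := hM
  refine ⟨adjunctionOfAlgebra
    (adjunctionOfIso (adj X.A) (eqToIso (M.η_T_μ X.A))) (eqToIso (M.η_T_μ X.A)) rfl
    (eqToIso (M.T_η_μ X.A)) (eqToIso (M.η_naturality X.a)) (eqToIso (M.η_naturality (M.η X.A)))
    ((M.T.mapId X.A).symm ≪≫ M.T.map₂Iso X.a₀ ≪≫ M.T.mapComp (M.η X.A) X.a) X.a₀ X.a₂
    X.left_unit ?_ ?_ ?_, rfl⟩
  · refine Eq.trans ?_ X.right_unit
    dsimp
    bicategory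
  -- By strictness every 2-cell here is an `eqToHom`.
  · simp [bicategoricalComp, Strict.associator_eqToIso]
  -- `unit_nat` is 2-naturality of `η` at `a₀`.
  · have := M.η_naturality₂ X.a₀.hom
    rw [← cancel_mono (eqToHom (M.η_naturality (M.η X.A ≫ X.a)).symm)] at this
    simp [bicategoricalComp, Strict.associator_eqToIso, Strict.leftUnitor_eqToIso,
      Strict.rightUnitor_eqToIso, M.T.mapComp_eq_eqToIso, M.T.mapId_eq_eqToIso] at this ⊢
    simp [this]

end TwoMonad
end AlgKan

theorem proposition4p12 {K : Type u} [Bicategory.{w, v} K] [Bicategory.Strict K]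
    (hK : AlgKan.HasCommaObjects K) (M : AlgKan.TwoMonad K) (hM : M.IsColaxIdempotent)
    (X Y : AlgKan.TwoMonad.PseudoAlgebra M) (F : AlgKan.TwoMonad.ColaxMorphism X Y) :
    F.IsExact := by
  obtain ⟨adj, h⟩ := hM.exists_adjunction X
  obtain ⟨adj', h'⟩ := hM.exists_adjunction Y
  refine AlgKan.isExactSquare_of_adjunction hK adj adj' (eqToIso (M.η_naturality F.f)) F.fbar ?_
  -- With both units equal to the `a₀`, mate compatibility becomes the unit axiom.
  rw [h, h']
  exact F.unit
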